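/- Let $n\ge 1$ and $r\ge 0$ be integers and let $\mathbf Z_n\subset\mathbf C^\times$ be the group of $n$-th roots of unity. Let $\mathbf C^\infty=\bigcup_s\mathbf C^s$ be the space of finitely supported complex sequences with the colimit topology, and let $M=\mathbf C^\infty$ be the $\mathbf Z_n$-module with $\gamma\cdot(z_1,z_2,\dots)=(\gamma z_1,\gamma^2z_2,\dots)$. Let $V_{r,s}$ be the space of orthonormal $r$-frames in $\mathbf C^s$ and $V_{r,\infty}=\varinjlim_s V_{r,s}$, with the colimit topology, the left action of $\mathbf Z_n\times U(r)$ given by $$(\gamma,a)\cdot(v_1,\dots,v_r)=(w_1,\dots,w_r),\qquad w_j^k=\gamma^k\sum_{i=1}^r\overline{a_{ji}}\,v_i^k ,$$ the resulting $\mathbf Z_n$-action $\gamma\cdot v=(\gamma,I_r)\cdot v$ and the right $U(r)$-action $v\cdot a=(1,a^{-1})\cdot v$. Let $G_{r,\infty}$ be the set of $r$-dimensional subspaces of $M$, with the quotient topology of the map $V_{r,\infty}\to G_{r,\infty}$, $(v_1,\dots,v_r)\mapsto\langle v_1,\dots,v_r\rangle$, and the induced $\mathbf Z_n$-action. Let $$E_M=\{(N,z):z\in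 N\}\subseteq G_{r,\infty}\times M$$ with the subspace topology and $\gamma(N,z)=(\gamma N,\gamma z)$. Let $V_{r,\infty}\times_{U(r)}\mathbf C^r$ be the quotient space of $V_{r,\infty}\times\mathbf C^r$ by the relation $(v\cdot a,y)\sim(v,ay)$, $a\in U(r)$, with $\gamma[v,y]=[\gamma v,y]$, projection $[v,y]\mapsto\langle v_1,\dots,v_r\rangle$, and the vector space structure on its fibres for which $y\mapsto[v,y]$ is linear for every $v$. Then $V_{r,\infty}\to G_{r,\infty}$ is a principal $(\mathbf Z_n;U(r))$-bundle (a locally trivial principal $U(r)$-bundle on which $\mathbf Z_n$ acts by bundle maps); the associated bundle $V_{r,\infty}\times_{U(r)}\mathbf C^r\to G_{r,\infty}$ and the canonical bundle $E_M\to G_{r,\infty}$ are $\mathbf Z_n$-equivariant (locally trivial) complex vector bundles; and the formula $$f\big[(v_1,\dots,v_r),y\big]=\Big(\langle v_1,\dots,v_r\rangle,\ \sum_{i=1}^r y_iv_i\Big)$$ defines an isomorphism of $\mathbf Z_n$-vector bundles over $G_{r,\infty}$ from $V_{r,\infty}\times_{U(r)}\mathbf C^r$ to $E_M$, that is, a $\mathbf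 Z_n$-equivariant homeomorphism which is a linear isomorphism from each fibre onto the fibre over the same point. -/

import Mathlib

open Bundle ComplexConjugate

namespace SegalBundle

noncomputable section

/-! ### The groups -/

/-- The cyclic group of order `n`, realised as the group of complex `n`-th roots of unity.  (It is
finite, so an action of it is continuous as soon as each of its elements acts continuously.) -/
def Zn (n : ℕ) : Type := rootsOfUnity n ℂ

instance (n : ℕ) : CommGroup (Zn n) := inferInstanceAs (CommGroup (rootsOfUnity n ℂ))

/-- The complex number underlying an element of the cyclic group. -/
def Zn.val {n : ℕ} (γ : Zn n) : ℂ := ((γ : rootsOfUnity n ℂ).1 : ℂˣ)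

@[simp] theorem Zn.val_one {n : ℕ} : (1 : Zn n).val = 1 := rfl

@[simp] theorem Zn.val_mul {n : ℕ} (γ δ : Zn n) : (γ * δ).val = γ.val * δ.val := rfl

theorem Zn.norm_val {n : ℕ} [NeZero n] (γ : Zn n) : ‖γ.val‖ = 1 :=
  Complex.norm_eq_one_of_mem_rootsOfUnity (γ : rootsOfUnity n ℂ).2

theorem Zn.conj_pow_mul {n : ℕ} [NeZero n] (γ : Zn n) (k : ℕ) :
    conj (γ.val ^ k) * γ.val ^ k = 1 := by
  rw [mul_comm, Complex.mul_conj, Complex.normSq_eq_norm_sq, norm_pow, γ.norm_val]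
  simp

/-- The unitary group `U(r)`, with the topology inherited from the space of matrices. -/
abbrev U (r : ℕ) := Matrix.unitaryGroup (Fin r) ℂ

/-! ### The space `ℂ^∞` -/

/-- `ℂ^∞ = ⋃ ℂ^s`: finitely supported complex sequences.  The index `k : ℕ` stands for the
coordinate number `k + 1`. -/
abbrev CInf := ℕ →₀ ℂ

/-- The inclusion `ℂ^s ⊆ ℂ^∞`. -/
def incl (s : ℕ) : EuclideanSpace ℂ (Fin s) →ₗ[ℂ] CInf :=
  Finsupp.lmapDomain ℂ ℂ Fin.val ∘ₗ (Finsupp.linearEquivFunOnFinite ℂ ℂ (Fin s)).symm.toLinearMap ∘ₗ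
    (WithLp.linearEquiv 2 ℂ (Fin s → ℂ)).toLinearMap

theorem incl_apply (s : ℕ) (z : EuclideanSpace ℂ (Fin s)) (k : Fin s) : incl s z k = z k := by
  simp only [incl, LinearMap.comp_apply, Finsupp.lmapDomain_apply]
  rw [Finsupp.mapDomain_apply Fin.val_injective]
  rfl

theorem incl_apply_of_le (s : ℕ) (z : EuclideanSpace ℂ (Fin s)) (k : ℕ) (hk : s ≤ k) :
    incl s z k = 0 := by
  simp only [incl, LinearMap.comp_apply, Finsupp.lmapDomain_apply]
  refine Finsupp.mapDomain_of_notMem_range _ _ ?_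
  rintro ⟨i, rfl⟩
  omega

/-- `ℂ^∞` has the colimit topology of the spaces `ℂ^s`. -/
instance : TopologicalSpace CInf :=
  ⨆ s : ℕ, TopologicalSpace.coinduced (incl s) inferInstance

/-- The standard Hermitian product of `ℂ^∞`, conjugate linear in the first variable. -/
def herm (z w : CInf) : ℂ := z.sum fun k a => conj a * w k

theorem herm_eq_sum (z w : CInf) (s : Finset ℕ) (hs : z.support ⊆ s) :
    herm z w = ∑ k ∈ s, conj (z k) * w k :=
  Finsupp.sum_of_support_subset _ hs _ (by simp)

theorem herm_add_right (z w w' : CInf) : herm z (w + w') = herm z w + herm z w' := by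
  simp [herm, mul_add, Finsupp.sum_add]

theorem herm_smul_right (c : ℂ) (z w : CInf) : herm z (c • w) = c * herm z w := by
  simp only [herm, Finsupp.sum, Finset.mul_sum]
  refine Finset.sum_congr rfl fun k _ => ?_
  simp only [Finsupp.smul_apply, smul_eq_mul]
  ring

theorem conj_herm (z w : CInf) : conj (herm w z) = herm z w := by
  rw [herm_eq_sum z w (z.support ∪ w.support) Finset.subset_union_left,
    herm_eq_sum w z (z.support ∪ w.support) Finset.subset_union_right, map_sum]
  refine Finset.sum_congr rfl fun k _ => ?_
  simp [mul_comm]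

theorem herm_self (z : CInf) : herm z z = ((∑ k ∈ z.support, ‖z k‖ ^ 2 : ℝ) : ℂ) := by
  rw [herm_eq_sum z z z.support subset_rfl]
  push_cast
  refine Finset.sum_congr rfl fun k _ => ?_
  rw [mul_comm, Complex.mul_conj, Complex.normSq_eq_norm_sq]
  push_cast
  rfl

/-- `herm z` as a linear form. -/
def hermL (z : CInf) : CInf →ₗ[ℂ] ℂ where
  toFun := herm z
  map_add' := herm_add_right z
  map_smul' c w := herm_smul_right c z w

theorem herm_sum_right {ι : Type*} (s : Finset ι) (c : ι → ℂ) (z : CInf) (w : ι → CInf) :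
    herm z (∑ i ∈ s, c i • w i) = ∑ i ∈ s, c i * herm z (w i) := by
  refine (map_sum (hermL z) (fun i => c i • w i) s).trans ?_
  exact Finset.sum_congr rfl fun i _ => herm_smul_right _ _ _

theorem herm_sum_left {ι : Type*} (s : Finset ι) (c : ι → ℂ) (z : CInf) (w : ι → CInf) :
    herm (∑ i ∈ s, c i • w i) z = ∑ i ∈ s, conj (c i) * herm (w i) z := by
  rw [← conj_herm, herm_sum_right, map_sum]
  refine Finset.sum_congr rfl fun k _ => ?_
  rw [map_mul, conj_herm]

/-- The inclusion `ℂ^s ⊆ ℂ^∞` preserves Hermitian products. -/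
theorem herm_incl (s : ℕ) (z w : EuclideanSpace ℂ (Fin s)) :
    herm (incl s z) (incl s w) = inner ℂ z w := by
  rw [herm_eq_sum _ _ (Finset.range s), ← Fin.sum_univ_eq_sum_range
    (fun k => conj (incl s z k) * incl s w k), PiLp.inner_apply]
  · refine Finset.sum_congr rfl fun k _ => ?_
    rw [incl_apply, incl_apply, RCLike.inner_apply, mul_comm]
  · intro k hk
    by_contra h
    exact (Finsupp.mem_support_iff.1 hk) (incl_apply_of_le s z k (by simpa using h))

/-- The `Z_n`-module `M`: the vector space `ℂ^∞` on which `γ` acts by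
`γ (z_1, z_2, …) = (γ z_1, γ² z_2, …)`. -/
def repM (n : ℕ) : Representation ℂ (Zn n) CInf where
  toFun γ :=
    { toFun := fun z => Finsupp.onFinset z.support (fun k => γ.val ^ (k + 1) * z k)
        (fun k hk => Finsupp.mem_support_iff.2 (right_ne_zero_of_mul hk))
      map_add' := fun z w => by ext k; simp [mul_add]
      map_smul' := fun c z => by ext k; simp [mul_left_comm] }
  map_one' := by ext; simp
  map_mul' γ δ := by ext; simp [mul_pow, mul_assoc]

theorem repM_apply {n : ℕ} (γ : Zn n) (z : CInf) (k : ℕ) :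
    repM n γ z k = γ.val ^ (k + 1) * z k := rfl

theorem support_repM {n : ℕ} (γ : Zn n) (z : CInf) : (repM n γ z).support ⊆ z.support := by
  intro k hk
  rw [Finsupp.mem_support_iff, repM_apply] at hk
  exact Finsupp.mem_support_iff.2 (right_ne_zero_of_mul hk)

theorem herm_repM {n : ℕ} [NeZero n] (γ : Zn n) (z w : CInf) :
    herm (repM n γ z) (repM n γ w) = herm z w := by
  rw [herm_eq_sum (repM n γ z) _ z.support (support_repM γ z),
    herm_eq_sum z w z.support subset_rfl]
  refine Finset.sum_congr rfl fun k _ => ?_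
  rw [repM_apply, repM_apply, map_mul]
  linear_combination (conj (z k) * w k) * γ.conj_pow_mul (k + 1)

/-! ### Stiefel manifolds -/

/-- The finite Stiefel manifold `V_{r,s}` of orthonormal `r`-frames in `ℂ^s`. -/
abbrev StiefelFin (r s : ℕ) := {v : Fin r → EuclideanSpace ℂ (Fin s) // Orthonormal ℂ v}

/-- The Stiefel manifold `V_{r,∞}` of orthonormal `r`-frames in `ℂ^∞`. -/
@[ext]
structure Stiefel (r : ℕ) : Type where
  frame : Fin r → CInf
  herm_frame : ∀ i j, herm (frame i) (frame j) = if i = j then 1 else 0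

/-- The inclusion `V_{r,s} ⊆ V_{r,∞}`. -/
def stiefelIncl (r s : ℕ) (v : StiefelFin r s) : Stiefel r :=
  ⟨fun i => incl s (v.1 i), fun i j => by
    rw [herm_incl]; exact (orthonormal_iff_ite.1 v.2) i j⟩

/-- `V_{r,∞}` has the colimit topology of the spaces `V_{r,s}`. -/
instance (r : ℕ) : TopologicalSpace (Stiefel r) :=
  ⨆ s : ℕ, TopologicalSpace.coinduced (stiefelIncl r s) inferInstance

/-- As a set, `V_{r,∞}` is the union of the `V_{r,s}`. -/
theorem exists_stiefelIncl {r : ℕ} (v : Stiefel r) : ∃ s u, stiefelIncl r s u = v := by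
  let s : ℕ := (Finset.univ.biUnion fun i => (v.1 i).support).sup id + 1
  have hs : ∀ i k, s ≤ k → v.1 i k = 0 := by
    intro i k hk
    by_contra h
    have hm : k ∈ Finset.univ.biUnion fun i => (v.1 i).support :=
      Finset.mem_biUnion.2 ⟨i, Finset.mem_univ _, Finsupp.mem_support_iff.2 h⟩
    have := Finset.le_sup (f := id) hm
    simp only [id] at this
    omega
  let u : Fin r → EuclideanSpace ℂ (Fin s) := fun i => WithLp.toLp 2 fun k => v.1 i k
  have hu : ∀ i, incl s (u i) = v.1 i := by
    intro i
    ext k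
    by_cases hk : k < s
    · exact incl_apply s (u i) ⟨k, hk⟩
    · rw [incl_apply_of_le s _ k (by omega), hs i k (by omega)]
  refine ⟨s, ⟨u, ?_⟩, Stiefel.ext (funext hu)⟩
  rw [orthonormal_iff_ite]
  intro i j
  rw [← herm_incl, hu, hu, v.2 i j]

theorem Stiefel.herm_comb {r : ℕ} (v : Stiefel r) (y : Fin r → ℂ) (j : Fin r) :
    herm (v.1 j) (∑ i, y i • v.1 i) = y j := by
  rw [herm_sum_right]
  simp [v.2]

theorem Stiefel.linearIndependent {r : ℕ} (v : Stiefel r) : LinearIndependent ℂ v.1 := by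
  rw [Fintype.linearIndependent_iff]
  intro g hg i
  rw [← v.herm_comb g i, hg]
  simp [herm]

theorem herm_comb_comb {r : ℕ} (v : Stiefel r) (x y : Fin r → ℂ) :
    herm (∑ i, x i • v.1 i) (∑ i, y i • v.1 i) = ∑ i, conj (x i) * y i := by
  rw [herm_sum_left]
  simp only [v.herm_comb]

/-- The action of `(γ, a) ∈ Z_n × U(r)` on a frame: `w_j^k = γ^k ∑_i conj (a_{ji}) v_i^k`. -/
def Stiefel.act {n r : ℕ} [NeZero n] (γ : Zn n) (a : U r) (v : Stiefel r) : Stiefel r :=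
  ⟨fun j => repM n γ (∑ i, conj (a.1 j i) • v.1 i), fun i j => by
    rw [herm_repM, herm_comb_comb]
    have h := congrFun (congrFun (Matrix.mem_unitaryGroup_iff.1 a.2) i) j
    rw [Matrix.mul_apply, Matrix.one_apply] at h
    rw [← h]
    simp [Matrix.star_apply]⟩

theorem Stiefel.act_apply {n r : ℕ} [NeZero n] (γ : Zn n) (a : U r) (v : Stiefel r)
    (j : Fin r) (k : ℕ) :
    (Stiefel.act γ a v).1 j k = γ.val ^ (k + 1) * ∑ i, conj (a.1 j i) * v.1 i k := by
  simp only [Stiefel.act, repM_apply, Finsupp.finsetSum_apply, Finsupp.smul_apply, smul_eq_mul]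

/-- The left action of `Z_n × U(r)` on `V_{r,∞}`. -/
instance (n r : ℕ) [NeZero n] : MulAction (Zn n × U r) (Stiefel r) where
  smul g v := Stiefel.act g.1 g.2 v
  one_smul v := by
    refine Stiefel.ext (funext fun j => Finsupp.ext fun k => ?_)
    refine (Stiefel.act_apply _ _ v j k).trans ?_
    simp [Matrix.one_apply]
  mul_smul g h v := by
    refine Stiefel.ext (funext fun j => Finsupp.ext fun k => ?_)
    refine (Stiefel.act_apply _ _ v j k).trans ?_
    refine Eq.trans ?_ (Stiefel.act_apply _ _ (Stiefel.act h.1 h.2 v) j k).symm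
    simp only [Stiefel.act_apply, Prod.fst_mul, Prod.snd_mul, Zn.val_mul, mul_pow,
      Submonoid.coe_mul, Matrix.mul_apply, map_sum, map_mul, Finset.sum_mul, Finset.mul_sum]
    rw [Finset.sum_comm]
    refine Finset.sum_congr rfl fun i _ => Finset.sum_congr rfl fun l _ => ?_
    ring

theorem Stiefel.smul_def {n r : ℕ} [NeZero n] (g : Zn n × U r) (v : Stiefel r) :
    g • v = Stiefel.act g.1 g.2 v := rfl

/-- The action of `Z_n` on `V_{r,∞}`: `γ • v = (γ, 1) • v`. -/
instance (n r : ℕ) [NeZero n] : MulAction (Zn n) (Stiefel r) :=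
  MulAction.compHom (Stiefel r) (MonoidHom.inl (Zn n) (U r))

theorem Stiefel.zn_smul_def {n r : ℕ} [NeZero n] (γ : Zn n) (v : Stiefel r) :
    γ • v = ((γ, 1) : Zn n × U r) • v := rfl

theorem Stiefel.zn_smul_val {n r : ℕ} [NeZero n] (γ : Zn n) (v : Stiefel r) (j : Fin r) :
    (γ • v).1 j = repM n γ (v.1 j) := by
  ext k
  refine (Stiefel.act_apply _ _ v j k).trans ?_
  simp [Matrix.one_apply, repM_apply]

/-- The right action of `U(r)` on `V_{r,∞}`: `v <• a = (1, a⁻¹) • v`, where `1 ∈ Z_n`.  The choice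
of `n` does not matter, see `Stiefel.right_smul_eq`; here `n = 1`. -/
instance (r : ℕ) : MulAction (U r)ᵐᵒᵖ (Stiefel r) where
  smul a v := (((1 : Zn 1), (MulOpposite.unop a)⁻¹) : Zn 1 × U r) • v
  one_smul v := by
    change (((1 : Zn 1), (MulOpposite.unop (1 : (U r)ᵐᵒᵖ))⁻¹) : Zn 1 × U r) • v = v
    rw [MulOpposite.unop_one, inv_one]
    exact one_smul (Zn 1 × U r) v
  mul_smul a b v := by
    change (((1 : Zn 1), (MulOpposite.unop (a * b))⁻¹) : Zn 1 × U r) • v =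
      (((1 : Zn 1), (MulOpposite.unop a)⁻¹) : Zn 1 × U r) •
        (((1 : Zn 1), (MulOpposite.unop b)⁻¹) : Zn 1 × U r) • v
    rw [smul_smul, Prod.mk_mul_mk, one_mul, MulOpposite.unop_mul, mul_inv_rev]

theorem Stiefel.right_smul_eq (n : ℕ) [NeZero n] {r : ℕ} (v : Stiefel r) (a : U r) :
    MulOpposite.op a • v = (((1 : Zn n), a⁻¹) : Zn n × U r) • v := by
  refine Stiefel.ext (funext fun j => Finsupp.ext fun k => ?_)
  refine (Stiefel.act_apply (1 : Zn 1) a⁻¹ v j k).trans ?_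
  refine Eq.trans ?_ (Stiefel.act_apply (1 : Zn n) a⁻¹ v j k).symm
  simp

theorem Stiefel.right_smul_val {r : ℕ} (v : Stiefel r) (a : U r) (j : Fin r) :
    (MulOpposite.op a • v).1 j = ∑ i, a.1 i j • v.1 i := by
  ext k
  refine (Stiefel.act_apply (1 : Zn 1) a⁻¹ v j k).trans ?_
  simp [Finsupp.finsetSum_apply, ← Unitary.star_eq_inv, Matrix.star_apply]

theorem Stiefel.smul_right_smul {n r : ℕ} [NeZero n] (γ : Zn n) (v : Stiefel r) (a : U r) :
    γ • (MulOpposite.op a • v) = MulOpposite.op a • (γ • v) := by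
  rw [Stiefel.right_smul_eq n, Stiefel.right_smul_eq n, zn_smul_def, zn_smul_def, smul_smul,
    smul_smul]
  simp

/-! ### The Grassmannian -/

/-- The set `G_{r,∞}` of `r`-dimensional subspaces of `M`. -/
@[ext]
structure Grass (r : ℕ) : Type where
  space : Submodule ℂ CInf
  finite : Module.Finite ℂ space
  finrank_eq : Module.finrank ℂ space = r

/-- The projection `V_{r,∞} → G_{r,∞}`, `(v_1, …, v_r) ↦ ⟨v_1, …, v_r⟩`. -/
def Stiefel.span {r : ℕ} (v : Stiefel r) : Grass r :=
  ⟨Submodule.span ℂ (Set.range v.1), Module.Finite.span_of_finite ℂ (Set.finite_range v.1), by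
    rw [finrank_span_eq_card v.linearIndependent, Fintype.card_fin]⟩

/-- `G_{r,∞}` has the quotient topology from `V_{r,∞}`. -/
instance (r : ℕ) : TopologicalSpace (Grass r) :=
  TopologicalSpace.coinduced Stiefel.span inferInstance

/-- The linear automorphism of `M` given by an element of `Z_n`. -/
def repMEquiv {n : ℕ} (γ : Zn n) : CInf ≃ₗ[ℂ] CInf :=
  LinearEquiv.ofLinearMap (repM n γ) (repM n γ⁻¹)
    (by rw [← Module.End.mul_eq_comp, ← map_mul, mul_inv_cancel, map_one]; rfl)
    (by rw [← Module.End.mul_eq_comp, ← map_mul, inv_mul_cancel, map_one]; rfl)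

/-- The action of `Z_n` on `G_{r,∞}` by taking images of subspaces of `M`. -/
instance (n r : ℕ) : MulAction (Zn n) (Grass r) where
  smul γ N := ⟨N.1.map (repM n γ), have := N.finite; Module.Finite.map N.1 _, (LinearEquiv.finrank_map_eq (repMEquiv γ) N.1).trans N.finrank_eq⟩
  one_smul N := Grass.ext (by
    change N.1.map (repM n 1) = N.1
    rw [map_one]
    exact Submodule.map_id N.1)
  mul_smul γ δ N := Grass.ext (by
    change N.1.map (repM n (γ * δ)) = (N.1.map (repM n δ)).map (repM n γ)
    rw [map_mul, ← Submodule.map_comp]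
    rfl)

theorem Grass.smul_val {n r : ℕ} (γ : Zn n) (N : Grass r) : (γ • N).1 = N.1.map (repM n γ) := rfl

theorem Stiefel.span_smul {n r : ℕ} [NeZero n] (γ : Zn n) (v : Stiefel r) :
    (γ • v).span = γ • v.span := by
  refine Grass.ext ?_
  rw [Grass.smul_val]
  simp only [Stiefel.span]
  rw [Submodule.map_span, ← Set.range_comp]
  congr 2
  funext j
  exact Stiefel.zn_smul_val γ v j

/-- Two orthonormal frames with the same span differ by a unitary matrix. -/
theorem Stiefel.exists_right_smul {r : ℕ} (v w : Stiefel r) (h : v.span = w.span) :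
    ∃ a : U r, w = MulOpposite.op a • v := by
  have hw : ∀ j, w.1 j = ∑ i, herm (v.1 i) (w.1 j) • v.1 i := by
    intro j
    have hm : w.1 j ∈ Submodule.span ℂ (Set.range v.1) := by
      have : v.span.1 = w.span.1 := by rw [h]
      simp only [Stiefel.span] at this
      rw [this]
      exact Submodule.subset_span ⟨j, rfl⟩
    obtain ⟨c, hc⟩ := (Submodule.mem_span_range_iff_exists_fun ℂ).1 hm
    have : ∀ i, herm (v.1 i) (w.1 j) = c i := fun i => by rw [← hc, v.herm_comb]
    simp only [this, hc]
  refine ⟨⟨Matrix.of fun i j => herm (v.1 i) (w.1 j), ?_⟩, ?_⟩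
  · rw [Matrix.mem_unitaryGroup_iff']
    ext j k
    rw [Matrix.one_apply, ← w.2 j k]
    conv_rhs => rw [hw j, hw k]
    rw [herm_comb_comb, Matrix.mul_apply]
    rfl
  · refine Stiefel.ext (funext fun j => ?_)
    rw [Stiefel.right_smul_val]
    exact hw j

theorem Stiefel.span_right_smul {r : ℕ} (v : Stiefel r) (a : U r) :
    (MulOpposite.op a • v).span = v.span := by
  have key : ∀ (w : Stiefel r) (b : U r), (MulOpposite.op b • w).span.1 ≤ w.span.1 := by
    intro w b
    refine Submodule.span_le.2 ?_
    rintro _ ⟨j, rfl⟩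
    rw [Stiefel.right_smul_val]
    exact Submodule.sum_mem _ fun i _ =>
      Submodule.smul_mem _ _ (Submodule.subset_span ⟨i, rfl⟩)
  refine Grass.ext (le_antisymm (key v a) ?_)
  have := key (MulOpposite.op a • v) a⁻¹
  rwa [smul_smul, ← MulOpposite.op_mul, mul_inv_cancel, MulOpposite.op_one, one_smul] at this

/-- The Hermitian product as an inner product in the sense of the library. -/
@[reducible]
def hermCore : InnerProductSpace.Core ℂ CInf where
  inner := herm
  conj_inner_symm := conj_herm
  re_inner_nonneg z := by
    rw [herm_self]
    exact (Finset.sum_nonneg fun k _ => sq_nonneg _ : (0 : ℝ) ≤ _)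
  add_left x y z := by
    rw [← conj_herm, herm_add_right, map_add, conj_herm, conj_herm]
  smul_left x y c := by
    rw [← conj_herm, herm_smul_right, map_mul, conj_herm]
  definite z hz := by
    rw [herm_self, Complex.ofReal_eq_zero,
      Finset.sum_eq_zero_iff_of_nonneg fun k _ => sq_nonneg _] at hz
    ext k
    by_contra hk
    have := hz k (Finsupp.mem_support_iff.2 hk)
    simp at this
    exact hk this

theorem Stiefel.span_surjective (r : ℕ) : Function.Surjective (Stiefel.span (r := r)) := by
  rintro ⟨N, hN, hr⟩
  let _ : NormedAddCommGroup CInf := @InnerProductSpace.Core.toNormedAddCommGroup ℂ CInf _ _ _ hermCore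
  let _ : InnerProductSpace ℂ CInf := InnerProductSpace.ofCore hermCore.toCore
  let b := (stdOrthonormalBasis ℂ N).reindex (finCongr hr)
  have hb : ∀ i j, herm (b i : CInf) (b j : CInf) = if i = j then 1 else 0 := fun i j =>
    orthonormal_iff_ite.1 b.orthonormal i j
  refine ⟨⟨fun i => (b i : CInf), hb⟩, Grass.ext ?_⟩
  change Submodule.span ℂ (Set.range fun i => (b i : CInf)) = N
  have h1 : Submodule.span ℂ (Set.range b) = ⊤ := by
    have := b.toBasis.span_eq
    rwa [OrthonormalBasis.coe_toBasis] at this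
  have h2 := congrArg (Submodule.map N.subtype) h1
  rw [Submodule.map_span, Submodule.map_subtype_top, ← Set.range_comp] at h2
  exact h2

/-! ### The associated bundle `V_{r,∞} ×_{U(r)} ℂ^r` -/

/-- The relation `(v a, y) ∼ (v, a y)` on `V_{r,∞} × ℂ^r`. -/
def assocSetoid (r : ℕ) : Setoid (Stiefel r × (Fin r → ℂ)) where
  r p q := ∃ a : U r, p.1 = MulOpposite.op a • q.1 ∧ q.2 = a.1.mulVec p.2
  iseqv :=
    { refl := fun p => ⟨1, by simp⟩
      symm := by
        rintro ⟨v, y⟩ ⟨w, z⟩ ⟨a, h1, h2⟩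
        dsimp only at h1 h2
        subst h1 h2
        refine ⟨a⁻¹, ?_, ?_⟩
        · dsimp only
          rw [smul_smul, ← MulOpposite.op_mul, mul_inv_cancel, MulOpposite.op_one, one_smul]
        · dsimp only
          rw [Matrix.mulVec_mulVec, ← Submonoid.coe_mul, inv_mul_cancel, OneMemClass.coe_one,
            Matrix.one_mulVec]
      trans := by
        rintro ⟨v, y⟩ ⟨w, z⟩ ⟨u, x⟩ ⟨a, h1, h2⟩ ⟨b, h3, h4⟩
        dsimp only at h1 h2 h3 h4
        subst h1 h2 h3 h4
        refine ⟨b * a, ?_, ?_⟩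
        · dsimp only
          rw [MulOpposite.op_mul, mul_smul]
        · dsimp only
          rw [Matrix.mulVec_mulVec, ← Submonoid.coe_mul] }

/-- The total space `V_{r,∞} ×_{U(r)} ℂ^r` of the associated bundle. -/
def Assoc (r : ℕ) : Type := Quotient (assocSetoid r)

/-- The total space carries the quotient topology. -/
instance (r : ℕ) : TopologicalSpace (Assoc r) :=
  inferInstanceAs (TopologicalSpace (Quotient (assocSetoid r)))

/-- The class `[v, y]`. -/
def Assoc.mk {r : ℕ} (v : Stiefel r) (y : Fin r → ℂ) : Assoc r :=
  Quotient.mk (assocSetoid r) (v, y)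

theorem Assoc.mk_right_smul {r : ℕ} (v : Stiefel r) (a : U r) (y : Fin r → ℂ) :
    Assoc.mk (MulOpposite.op a • v) y = Assoc.mk v (a.1.mulVec y) :=
  Quotient.sound ⟨a, rfl, rfl⟩

/-- The bundle projection `[v, y] ↦ ⟨v_1, …, v_r⟩`. -/
def Assoc.proj {r : ℕ} (q : Assoc r) : Grass r :=
  Quotient.lift (fun p : Stiefel r × (Fin r → ℂ) => p.1.span) (by
    rintro ⟨v, y⟩ ⟨w, z⟩ ⟨a, h1, -⟩
    dsimp only at h1 ⊢
    rw [h1, Stiefel.span_right_smul]) q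

@[simp] theorem Assoc.proj_mk {r : ℕ} (v : Stiefel r) (y : Fin r → ℂ) :
    (Assoc.mk v y).proj = v.span := rfl

/-- The action `γ • [v, y] = [γ • v, y]`. -/
instance (n r : ℕ) [NeZero n] : MulAction (Zn n) (Assoc r) where
  smul γ q := Quotient.map (fun p : Stiefel r × (Fin r → ℂ) => (γ • p.1, p.2)) (by
    rintro ⟨v, y⟩ ⟨w, z⟩ ⟨a, h1, h2⟩
    dsimp only at h1 h2
    refine ⟨a, ?_, h2⟩
    dsimp only
    rw [h1, Stiefel.smul_right_smul]) q
  one_smul q := by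
    induction q using Quotient.inductionOn with
    | h p =>
      change Quotient.mk (assocSetoid r) ((1 : Zn n) • p.1, p.2) = Quotient.mk _ p
      rw [one_smul]
  mul_smul γ δ q := by
    induction q using Quotient.inductionOn with
    | h p =>
      change Quotient.mk (assocSetoid r) ((γ * δ) • p.1, p.2) =
        Quotient.mk _ (γ • δ • p.1, p.2)
      rw [mul_smul]

theorem Assoc.smul_mk {n r : ℕ} [NeZero n] (γ : Zn n) (v : Stiefel r) (y : Fin r → ℂ) :
    γ • Assoc.mk v y = Assoc.mk (γ • v) y := rfl

theorem Assoc.proj_smul {n r : ℕ} [NeZero n] (γ : Zn n) (q : Assoc r) :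
    (γ • q).proj = γ • q.proj := by
  induction q using Quotient.inductionOn with
  | h p => exact Stiefel.span_smul γ p.1

/-- The fibre of the associated bundle over `N`. -/
@[ext]
structure AssocFibre (r : ℕ) (N : Grass r) : Type where
  point : Assoc r
  proj_point : point.proj = N

/-- A frame `v` of `N` identifies `ℂ^r` with the fibre over `N`, by `y ↦ [v, y]`. -/
def frameEquiv {r : ℕ} (v : Stiefel r) (N : Grass r) (hv : v.span = N) :
    (Fin r → ℂ) ≃ AssocFibre r N :=
  Equiv.ofBijective (fun y => (⟨Assoc.mk v y, hv⟩ : AssocFibre r N)) (by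
    constructor
    · intro y z h
      obtain ⟨a, h1, h2⟩ := Quotient.exact (congrArg AssocFibre.point h)
      dsimp only at h1 h2
      have ha : a.1 = 1 := by
        refine Matrix.ext fun i j => ?_
        have h3 : herm (v.1 i) (v.1 j) = herm (v.1 i) ((MulOpposite.op a • v).1 j) :=
          congrArg (fun u : Stiefel r => herm (v.1 i) (u.1 j)) h1
        rw [Stiefel.right_smul_val, v.herm_comb, v.2] at h3
        rw [Matrix.one_apply, h3]
      rw [h2, ha, Matrix.one_mulVec]
    · rintro ⟨q, hq⟩
      induction q using Quotient.inductionOn with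
      | h p =>
        obtain ⟨a, ha⟩ := Stiefel.exists_right_smul v p.1 (hv.trans hq.symm)
        refine ⟨a.1.mulVec p.2, AssocFibre.ext ?_⟩
        dsimp only
        rw [← Assoc.mk_right_smul, ← ha]
        rfl)

/-- The vector space structure of the fibre over `N`, transported from `ℂ^r` along a frame of `N`;
it does not depend on the frame, see `AssocFibre.ofFrame_add` and `AssocFibre.ofFrame_smul`. -/
def chosenFrameEquiv (r : ℕ) (N : Grass r) : AssocFibre r N ≃ (Fin r → ℂ) :=
  (frameEquiv (Stiefel.span_surjective r N).choose N
    (Stiefel.span_surjective r N).choose_spec).symm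

instance (r : ℕ) (N : Grass r) : AddCommGroup (AssocFibre r N) :=
  (chosenFrameEquiv r N).addCommGroup

instance (r : ℕ) (N : Grass r) : Module ℂ (AssocFibre r N) :=
  (chosenFrameEquiv r N).module ℂ

/-- The point `[v, y]` in the fibre over the span of `v`. -/
def AssocFibre.ofFrame {r : ℕ} (v : Stiefel r) (y : Fin r → ℂ) : AssocFibre r v.span :=
  ⟨Assoc.mk v y, Assoc.proj_mk v y⟩

theorem exists_mulVec_chosenFrameEquiv {r : ℕ} (v : Stiefel r) :
    ∃ a : U r, ∀ y, chosenFrameEquiv r v.span (AssocFibre.ofFrame v y) = a.1.mulVec y := by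
  obtain ⟨a, ha⟩ := Stiefel.exists_right_smul _ v (Stiefel.span_surjective r v.span).choose_spec
  refine ⟨a, fun y => (Equiv.symm_apply_eq _).2 (AssocFibre.ext ?_)⟩
  change Assoc.mk v y = Assoc.mk _ (a.1.mulVec y)
  rw [← Assoc.mk_right_smul, ← ha]

/-- In every frame, addition in the fibres is `[v, y] + [v, z] = [v, y + z]`. -/
theorem AssocFibre.ofFrame_add {r : ℕ} (v : Stiefel r) (y z : Fin r → ℂ) :
    AssocFibre.ofFrame v y + AssocFibre.ofFrame v z = AssocFibre.ofFrame v (y + z) := by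
  obtain ⟨a, ha⟩ := exists_mulVec_chosenFrameEquiv v
  change (chosenFrameEquiv r v.span).symm (chosenFrameEquiv r v.span (ofFrame v y) +
    chosenFrameEquiv r v.span (ofFrame v z)) = _
  rw [Equiv.symm_apply_eq, ha, ha, ha, Matrix.mulVec_add]

/-- In every frame, scalar multiplication in the fibres is `c • [v, y] = [v, c • y]`. -/
theorem AssocFibre.ofFrame_smul {r : ℕ} (v : Stiefel r) (c : ℂ) (y : Fin r → ℂ) :
    c • AssocFibre.ofFrame v y = AssocFibre.ofFrame v (c • y) := by
  obtain ⟨a, ha⟩ := exists_mulVec_chosenFrameEquiv v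
  change (chosenFrameEquiv r v.span).symm (c • chosenFrameEquiv r v.span (ofFrame v y)) = _
  rw [Equiv.symm_apply_eq, ha, ha, Matrix.mulVec_smul]

/-- The disjoint union of the fibres is `V_{r,∞} ×_{U(r)} ℂ^r`. -/
def assocTotalEquiv (r : ℕ) : TotalSpace (Fin r → ℂ) (AssocFibre r) ≃ Assoc r where
  toFun e := e.2.1
  invFun q := ⟨q.proj, ⟨q, rfl⟩⟩
  left_inv := by rintro ⟨_, ⟨q, rfl⟩⟩; rfl
  right_inv q := rfl

instance (r : ℕ) : TopologicalSpace (TotalSpace (Fin r → ℂ) (AssocFibre r)) :=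
  TopologicalSpace.induced (assocTotalEquiv r) inferInstance

instance (n r : ℕ) [NeZero n] : MulAction (Zn n) (TotalSpace (Fin r → ℂ) (AssocFibre r)) :=
  (assocTotalEquiv r).mulAction (Zn n)

/-! ### The tautological bundle `E_M` -/

/-- The fibre of the tautological bundle over the subspace `N` is `N` itself. -/
abbrev TautFibre (r : ℕ) (N : Grass r) : Type := N.1

/-- The identification `E_M = {(N, z) : z ∈ N} ⊆ G_{r,∞} × M`. -/
def tautToProd (r : ℕ) (e : TotalSpace (Fin r → ℂ) (TautFibre r)) : Grass r × CInf :=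
  (e.1, (e.2 : CInf))

/-- `E_M` has the subspace topology of `G_{r,∞} × M`. -/
instance (r : ℕ) : TopologicalSpace (TotalSpace (Fin r → ℂ) (TautFibre r)) :=
  TopologicalSpace.induced (tautToProd r) inferInstance

theorem tautToProd_injective (r : ℕ) : Function.Injective (tautToProd r) := by
  rintro ⟨N, z, hz⟩ ⟨N', z', hz'⟩ h
  obtain ⟨rfl, h2⟩ := Prod.mk.inj h
  dsimp only at h2
  subst h2
  rfl

/-- The action `γ • (N, z) = (γ N, γ z)`. -/
instance (n r : ℕ) : MulAction (Zn n) (TotalSpace (Fin r → ℂ) (TautFibre r)) where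
  smul γ e := ⟨γ • e.1, ⟨repM n γ (e.2 : CInf), Submodule.mem_map_of_mem e.2.2⟩⟩
  one_smul e := tautToProd_injective r (Prod.ext (one_smul (Zn n) e.1) (by
    change repM n 1 (e.2 : CInf) = e.2
    rw [map_one]
    rfl))
  mul_smul γ δ e := tautToProd_injective r (Prod.ext (mul_smul γ δ e.1) (by
    change repM n (γ * δ) (e.2 : CInf) = repM n γ (repM n δ (e.2 : CInf))
    rw [map_mul]
    rfl))

/-! ### Equivariant bundles and their isomorphisms -/

/-- `p : P → B` is a principal `(Γ; G)`-bundle, for a finite group `Γ`: a locally trivial principal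
`G`-bundle (with right action of `G`) on which `Γ` acts by bundle maps. -/
structure IsEquivariantPrincipalBundle (Γ G : Type*) [Group Γ] [Group G] [TopologicalSpace G]
    {P B : Type*} [TopologicalSpace P] [TopologicalSpace B] [MulAction Γ P] [MulAction Γ B]
    [MulAction Gᵐᵒᵖ P] (p : P → B) : Prop where
  continuous_proj : Continuous p
  continuous_smul_base : ∀ γ : Γ, Continuous fun b : B => γ • b
  continuous_smul : ∀ γ : Γ, Continuous fun x : P => γ • x
  continuous_right_smul : Continuous fun x : P × G => MulOpposite.op x.2 • x.1
  proj_smul : ∀ (γ : Γ) (x : P), p (γ • x) = γ • p x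
  proj_right_smul : ∀ (x : P) (g : G), p (MulOpposite.op g • x) = p x
  smul_right_smul : ∀ (γ : Γ) (x : P) (g : G),
    γ • (MulOpposite.op g • x) = MulOpposite.op g • (γ • x)
  locally_trivial : ∀ b : B, ∃ e : Trivialization G p, b ∈ e.baseSet ∧
    ∀ x : P, p x ∈ e.baseSet → ∀ g : G, (e (MulOpposite.op g • x)).2 = (e x).2 * g

/-- The family `E` of complex vector spaces over `B` (with the given topology and `Γ`-action on
its total space) is a `Γ`-equivariant complex vector bundle with typical fibre `F`, for a finite
group `Γ`: it is locally trivial, `Γ` acts continuously on the base and on the total space, and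
`γ` maps the fibre over `b` linearly to the fibre over `γ b`. -/
structure IsEquivariantVectorBundle (Γ : Type*) [Group Γ] {B : Type*} [TopologicalSpace B]
    [MulAction Γ B] (F : Type*) [NormedAddCommGroup F] [NormedSpace ℂ F] (E : B → Type*)
    [∀ b, AddCommGroup (E b)] [∀ b, Module ℂ (E b)] [TopologicalSpace (TotalSpace F E)]
    [MulAction Γ (TotalSpace F E)] : Prop where
  continuous_proj : Continuous (TotalSpace.proj : TotalSpace F E → B)
  locally_trivial : ∀ b : B, ∃ e : Trivialization F (TotalSpace.proj : TotalSpace F E → B),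
    b ∈ e.baseSet ∧ e.IsLinear ℂ
  continuous_smul_base : ∀ γ : Γ, Continuous fun b : B => γ • b
  continuous_smul : ∀ γ : Γ, Continuous fun x : TotalSpace F E => γ • x
  smul_linear : ∀ (γ : Γ) (b : B), ∃ L : E b →ₗ[ℂ] E (γ • b),
    ∀ x : E b, γ • (⟨b, x⟩ : TotalSpace F E) = ⟨γ • b, L x⟩

/-- `f` is an isomorphism of `Γ`-equivariant complex vector bundles over `B`: a `Γ`-equivariant
homeomorphism of total spaces that maps the fibre over each `b` linearly isomorphically onto the
fibre over the same `b`. -/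
structure IsEquivariantVectorBundleIso (Γ : Type*) [Group Γ] {B : Type*} {F : Type*}
    {E E' : B → Type*} [∀ b, AddCommGroup (E b)] [∀ b, Module ℂ (E b)]
    [∀ b, AddCommGroup (E' b)] [∀ b, Module ℂ (E' b)]
    [TopologicalSpace (TotalSpace F E)] [TopologicalSpace (TotalSpace F E')]
    [MulAction Γ (TotalSpace F E)] [MulAction Γ (TotalSpace F E')]
    (f : TotalSpace F E → TotalSpace F E') : Prop where
  isHomeomorph : IsHomeomorph f
  fibre_linear : ∀ b : B, ∃ L : E b ≃ₗ[ℂ] E' b, ∀ x : E b, f ⟨b, x⟩ = ⟨b, L x⟩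
  equivariant : ∀ (γ : Γ) (x : TotalSpace F E), f (γ • x) = γ • f x

end

end SegalBundle

open SegalBundle

/-!
For frames `v` and `w`, the matrix `(⟨v_i, w_j⟩)` of Hermitian products is multiplied on the right
by `a ∈ U(r)` when `w` is replaced by `w · a`, and so is the unitary factor of its polar
decomposition. Over the open set of subspaces where the matrix is invertible, this factor is
therefore a `U(r)`-equivariant coordinate on the frames, which yields a local section `σ` and a
trivialization of the principal bundle.

A local section `σ` trivializes `E_M` by `(N, z) ↦ (⟨σ(N)_i, z⟩)_i`, and the inverse of `f` is
locally `(N, z) ↦ [σ(N), (⟨σ(N)_i, z⟩)_i]`. Both are continuous because the Hermitian product is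
jointly continuous, the colimit topology being finer than that of `ℓ²`. Maps out of a product of
`V_{r,∞}` with `U(r)` or `ℂ^r` can be checked on the finite stages, since these factors are locally
compact. The vector bundle structure of the associated bundle is transported along `f`.
-/

namespace SegalBundle

section PolarDecomposition

variable {A : Type*} [CStarAlgebra A] [PartialOrder A] [StarOrderedRing A]

theorem isUnit_abs_star {a : A} (ha : IsUnit a) : IsUnit (CFC.abs (star a)) := by
  rw [← isUnit_pow_iff two_ne_zero, CFC.abs_sq, star_star]
  exact ha.mul ha.star

/-- The factor `u` of the polar decomposition `a = |a*| u`. It is written with `Ring.inverse`, so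
that it is `0` at those `a` where `|a*|` is not invertible. -/
noncomputable def polarFactor (a : A) : A :=
  Ring.inverse (CFC.abs (star a)) * a

theorem abs_star_mul_unitary (a : A) (u : unitary A) :
    CFC.abs (star (a * u.1)) = CFC.abs (star a) := by
  have h : star (star (a * u.1)) * star (a * u.1) = star (star a) * star a := by
    rw [star_star, star_star, star_mul, mul_assoc, ← mul_assoc u.1,
      Unitary.mul_star_self_of_mem u.2, one_mul]
  rw [CFC.abs, h, CFC.abs]

theorem polarFactor_mul_unitary (a : A) (u : unitary A) :
    polarFactor (a * u.1) = polarFactor a * u.1 := by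
  rw [polarFactor, abs_star_mul_unitary, polarFactor, mul_assoc]

theorem polarFactor_mem_unitary {a : A} (ha : IsUnit a) : polarFactor a ∈ unitary A := by
  set b := CFC.abs (star a) with hb
  have hbu : IsUnit b := isUnit_abs_star ha
  have hsq : a * star a = b * b := by rw [hb, CFC.abs_mul_abs, star_star]
  have hstar : star (Ring.inverse b) = Ring.inverse b := by
    rw [← Ring.inverse_star, (CFC.abs_nonneg (star a)).isSelfAdjoint.star_eq]
  have hmul : polarFactor a * star (polarFactor a) = 1 :=
    calc Ring.inverse b * a * star (Ring.inverse b * a)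
        = Ring.inverse b * (a * star a) * Ring.inverse b := by
          rw [star_mul, hstar]; simp only [mul_assoc]
      _ = 1 := by
          rw [hsq, Ring.inverse_mul_cancel_left _ _ hbu, Ring.mul_inverse_cancel _ hbu]
  have hu : IsUnit (polarFactor a) := hbu.ringInverse.mul ha
  exact Unitary.mem_iff.2 ⟨hu.mul_left_cancel (by rw [← mul_assoc, hmul, one_mul, mul_one]), hmul⟩

theorem continuousOn_polarFactor : ContinuousOn (polarFactor : A → A) {a | IsUnit a} := by
  intro a ha
  obtain ⟨u, hu⟩ := isUnit_abs_star ha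
  have habs : Continuous fun a : A => CFC.abs (star a) := CFC.continuous_abs.comp continuous_star
  have hinv : ContinuousAt Ring.inverse (CFC.abs (star a)) :=
    hu ▸ NormedRing.inverse_continuousAt u
  have hinv_abs : ContinuousAt (fun a : A => Ring.inverse (CFC.abs (star a))) a :=
    hinv.comp_of_eq habs.continuousAt rfl
  exact (hinv_abs.mul continuousAt_id).continuousWithinAt

open Classical in
/-- The polar factor as an element of the unitary group; `1` at the non-invertible elements. -/
noncomputable def polarUnitary (a : A) : unitary A :=
  if ha : IsUnit a then ⟨polarFactor a, polarFactor_mem_unitary ha⟩ else 1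

theorem coe_polarUnitary {a : A} (ha : IsUnit a) : (polarUnitary a : A) = polarFactor a := by
  rw [polarUnitary, dif_pos ha]

theorem polarUnitary_mul_unitary {a : A} (ha : IsUnit a) (u : unitary A) :
    polarUnitary (a * u.1) = polarUnitary a * u := by
  have hau : IsUnit (a * u.1) := ha.mul (Unitary.toUnits u).isUnit
  refine Subtype.ext ?_
  rw [Submonoid.coe_mul, coe_polarUnitary hau, coe_polarUnitary ha, polarFactor_mul_unitary]

theorem continuousOn_polarUnitary : ContinuousOn (polarUnitary : A → unitary A) {a | IsUnit a} :=
  Topology.IsInducing.subtypeVal.continuousOn_iff.2 <|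
    continuousOn_polarFactor.congr fun _ ha => coe_polarUnitary ha

end PolarDecomposition

section Trivialization

variable {B F Z : Type*} [TopologicalSpace B] [TopologicalSpace F] [TopologicalSpace Z]

theorem exists_trivialization_of_continuousOn {p : Z → B} (hp : Continuous p) {U : Set B}
    (hU : IsOpen U) {φ : Z → F} {ψ : B × F → Z} (hφ : ContinuousOn φ (p ⁻¹' U))
    (hψ : ContinuousOn ψ (U ×ˢ Set.univ)) (hpψ : ∀ b ∈ U, ∀ y, p (ψ (b, y)) = b)
    (hφψ : ∀ b ∈ U, ∀ y, φ (ψ (b, y)) = y) (hψφ : ∀ x, p x ∈ U → ψ (p x, φ x) = x) :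
    ∃ e : Trivialization F p, e.baseSet = U ∧ ∀ x, e x = (p x, φ x) :=
  ⟨{  toFun := fun x => (p x, φ x)
      invFun := ψ
      source := p ⁻¹' U
      target := U ×ˢ Set.univ
      map_source' := fun _ hx => ⟨hx, trivial⟩
      map_target' := fun q hq => Set.mem_preimage.2 <| (hpψ q.1 hq.1 q.2).symm ▸ hq.1
      left_inv' := hψφ
      right_inv' := fun q hq => Prod.ext (hpψ q.1 hq.1 q.2) (hφψ q.1 hq.1 q.2)
      open_source := hU.preimage hp
      open_target := hU.prod isOpen_univ
      continuousOn_toFun := hp.continuousOn.prodMk hφ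
      continuousOn_invFun := hψ
      baseSet := U
      open_baseSet := hU
      source_eq := rfl
      target_eq := rfl
      proj_toFun := fun _ _ => rfl }, rfl, fun _ => rfl⟩

theorem exists_trivialization_comp_homeomorph {Z' : Type*} [TopologicalSpace Z'] {p : Z → B}
    {p' : Z' → B} (f : Z ≃ₜ Z') (hf : p' ∘ f = p) (e : Trivialization F p') :
    ∃ e' : Trivialization F p, e'.baseSet = e.baseSet ∧ ∀ x, e' x = e (f x) := by
  subst hf
  exact ⟨e.compHomeomorph f, rfl, fun _ => rfl⟩

end Trivialization

section FibreCoordinate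

open MulOpposite (op)

variable {G P B : Type*} [Group G] [MulAction Gᵐᵒᵖ P] {p : P → B}

/-- The section of `p` with value `1` in the fibre coordinate `R`, obtained by translating an
arbitrary point of each fibre. -/
noncomputable def coordinateSection (hp : Function.Surjective p) (R : P → G) (b : B) : P :=
  op (R (Function.surjInv hp b))⁻¹ • Function.surjInv hp b

theorem proj_coordinateSection (hp : Function.Surjective p) (R : P → G)
    (horbit : ∀ x y, p x = p y ↔ ∃ g : G, y = op g • x) (b : B) :
    p (coordinateSection hp R b) = b :=
  ((horbit _ _).2 ⟨_, rfl⟩).symm.trans (Function.surjInv_eq hp b)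

variable [TopologicalSpace G] [TopologicalSpace P] [TopologicalSpace B] {U : Set B} {R : P → G}

/-- A coordinate along the fibres of `p : P → B` over the open set `U`: a continuous map from
`p ⁻¹' U` to `G` that is equivariant for the right actions of `G`. The map `R` is total, but its
values outside `p ⁻¹' U` are irrelevant. -/
structure IsFibreCoordinate (p : P → B) (U : Set B) (R : P → G) : Prop where
  isOpen : IsOpen U
  continuousOn : ContinuousOn R (p ⁻¹' U)
  map_op_smul : ∀ x, p x ∈ U → ∀ g, R (op g • x) = R x * g

namespace IsFibreCoordinate

theorem coordinateSection_proj (hR : IsFibreCoordinate p U R) (hp : Function.Surjective p)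
    (horbit : ∀ x y, p x = p y ↔ ∃ g : G, y = op g • x) {x : P} (hx : p x ∈ U) :
    coordinateSection hp R (p x) = op (R x)⁻¹ • x := by
  obtain ⟨g, hg⟩ := (horbit x _).1 (Function.surjInv_eq hp (p x)).symm
  rw [coordinateSection, hg, hR.map_op_smul x hx, smul_smul, ← MulOpposite.op_mul, mul_inv_rev,
    mul_inv_cancel_left]

theorem coordinate_coordinateSection (hR : IsFibreCoordinate p U R) (hp : Function.Surjective p)
    {b : B} (hb : b ∈ U) : R (coordinateSection hp R b) = 1 := by
  rw [coordinateSection, hR.map_op_smul _ ((Function.surjInv_eq hp b).symm ▸ hb), mul_inv_cancel]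

theorem continuousOn_coordinateSection [IsTopologicalGroup G] [ContinuousSMul Gᵐᵒᵖ P]
    (hR : IsFibreCoordinate p U R) (hp : Topology.IsQuotientMap p)
    (horbit : ∀ x y, p x = p y ↔ ∃ g : G, y = op g • x) :
    ContinuousOn (coordinateSection hp.surjective R) U := by
  rw [hp.continuousOn_isOpen_iff hR.isOpen]
  have htranslate : ContinuousOn (fun x => op (R x)⁻¹ • x) (p ⁻¹' U) :=
    (MulOpposite.continuous_op.comp_continuousOn hR.continuousOn.inv).smul continuousOn_id
  exact htranslate.congr fun x hx => hR.coordinateSection_proj hp.surjective horbit hx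

theorem exists_trivialization [IsTopologicalGroup G] [ContinuousSMul Gᵐᵒᵖ P]
    (hR : IsFibreCoordinate p U R) (hp : Topology.IsQuotientMap p)
    (horbit : ∀ x y, p x = p y ↔ ∃ g : G, y = op g • x) :
    ∃ e : Trivialization G p, e.baseSet = U ∧ ∀ x, e x = (p x, R x) := by
  set σ := coordinateSection hp.surjective R
  have hpσ : ∀ b, p (σ b) = b := proj_coordinateSection hp.surjective R horbit
  refine exists_trivialization_of_continuousOn (ψ := fun q => op q.2 • σ q.1) hp.continuous
    hR.isOpen hR.continuousOn ?_ (fun b _ g => ?_) (fun b hb g => ?_) fun x hx => ?_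
  · exact (MulOpposite.continuous_op.comp continuous_snd).continuousOn.smul
      ((hR.continuousOn_coordinateSection hp horbit).comp continuousOn_fst fun _ hq => hq.1)
  · exact ((horbit _ _).2 ⟨g, rfl⟩).symm.trans (hpσ b)
  · rw [hR.map_op_smul _ ((hpσ b).symm ▸ hb), hR.coordinate_coordinateSection hp.surjective hb,
      one_mul]
  · dsimp only [σ]
    rw [hR.coordinateSection_proj hp.surjective horbit hx, smul_smul, ← MulOpposite.op_mul,
      inv_mul_cancel, MulOpposite.op_one, one_smul]

end IsFibreCoordinate

end FibreCoordinate

section VectorBundle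

variable {Γ : Type*} [Group Γ] {B : Type*} {F : Type*} {E E' : B → Type*}
  [∀ b, AddCommGroup (E b)] [∀ b, Module ℂ (E b)]
  [∀ b, AddCommGroup (E' b)] [∀ b, Module ℂ (E' b)]
  [TopologicalSpace (TotalSpace F E)] [TopologicalSpace (TotalSpace F E')]
  [MulAction Γ (TotalSpace F E)] [MulAction Γ (TotalSpace F E')]
  {f : TotalSpace F E → TotalSpace F E'}

theorem IsEquivariantVectorBundleIso.proj_comp (hf : IsEquivariantVectorBundleIso Γ f) :
    TotalSpace.proj ∘ f = TotalSpace.proj := by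
  funext ⟨b, x⟩
  obtain ⟨L, hL⟩ := hf.fibre_linear b
  rw [Function.comp_apply, hL]

theorem IsEquivariantVectorBundleIso.exists_linear_trivialization [TopologicalSpace B]
    [NormedAddCommGroup F] [NormedSpace ℂ F] (hf : IsEquivariantVectorBundleIso Γ f)
    (e : Trivialization F (TotalSpace.proj : TotalSpace F E' → B)) [e.IsLinear ℂ] :
    ∃ e' : Trivialization F (TotalSpace.proj : TotalSpace F E → B),
      e'.baseSet = e.baseSet ∧ e'.IsLinear ℂ := by
  obtain ⟨e', hbase, he'⟩ :=
    exists_trivialization_comp_homeomorph hf.isHomeomorph.homeomorph hf.proj_comp e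
  refine ⟨e', hbase, ⟨fun b hb => ?_⟩⟩
  obtain ⟨L, hL⟩ := hf.fibre_linear b
  have hlin : IsLinearMap ℂ fun x : E b => (e ⟨b, L x⟩).2 :=
    (((e.linear ℂ (hbase ▸ hb)).mk' _).comp L.toLinearMap).isLinear
  simpa only [he', IsHomeomorph.homeomorph_apply, hL] using hlin

theorem IsEquivariantVectorBundleIso.smul_linear [MulAction Γ B]
    (hf : IsEquivariantVectorBundleIso Γ f) {γ : Γ} {b : B} {S : E' b →ₗ[ℂ] E' (γ • b)}
    (hS : ∀ x, γ • (⟨b, x⟩ : TotalSpace F E') = ⟨γ • b, S x⟩) :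
    ∃ T : E b →ₗ[ℂ] E (γ • b), ∀ x, γ • (⟨b, x⟩ : TotalSpace F E) = ⟨γ • b, T x⟩ := by
  obtain ⟨L, hL⟩ := hf.fibre_linear b
  obtain ⟨L', hL'⟩ := hf.fibre_linear (γ • b)
  refine ⟨L'.symm.toLinearMap ∘ₗ S ∘ₗ L.toLinearMap, fun x => hf.isHomeomorph.injective ?_⟩
  rw [hf.equivariant, hL, hS, hL', LinearMap.comp_apply, LinearEquiv.coe_coe,
    LinearEquiv.apply_symm_apply, LinearMap.comp_apply, LinearEquiv.coe_coe]

theorem IsEquivariantVectorBundleIso.continuous_smul (hf : IsEquivariantVectorBundleIso Γ f)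
    {γ : Γ} (hγ : Continuous fun x : TotalSpace F E' => γ • x) :
    Continuous fun x : TotalSpace F E => γ • x := by
  rw [hf.isHomeomorph.isInducing.continuous_iff]
  exact (hγ.comp hf.isHomeomorph.continuous).congr fun x => (hf.equivariant γ x).symm

theorem IsEquivariantVectorBundle.of_iso [TopologicalSpace B] [MulAction Γ B]
    [NormedAddCommGroup F] [NormedSpace ℂ F] (hf : IsEquivariantVectorBundleIso Γ f)
    (h : IsEquivariantVectorBundle Γ F E') : IsEquivariantVectorBundle Γ F E where
  continuous_proj := hf.proj_comp ▸ h.continuous_proj.comp hf.isHomeomorph.continuous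
  locally_trivial b := by
    obtain ⟨e, hb, _⟩ := h.locally_trivial b
    obtain ⟨e', hbase, he'⟩ := hf.exists_linear_trivialization e
    exact ⟨e', hbase ▸ hb, he'⟩
  continuous_smul_base := h.continuous_smul_base
  continuous_smul γ := hf.continuous_smul (h.continuous_smul γ)
  smul_linear γ b := let ⟨_, hS⟩ := h.smul_linear γ b; hf.smul_linear hS

end VectorBundle

theorem continuous_uncurry_of_iSup_coinduced {ι X Y Z : Type*} {A : ι → Type*}
    [∀ s, TopologicalSpace (A s)] [tX : TopologicalSpace X] [TopologicalSpace Y]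
    [TopologicalSpace Z] [LocallyCompactSpace Y] {i : ∀ s, A s → X}
    (htop : tX = ⨆ s, TopologicalSpace.coinduced (i s) inferInstance)
    (hsurj : ∀ x, ∃ s u, i s u = x) {g : X × Y → Z}
    (hg : ∀ s, Continuous fun p : A s × Y => g (i s p.1, p.2)) : Continuous g := by
  have hx : ∀ x, Continuous fun y => g (x, y) := fun x => by
    obtain ⟨s, u, rfl⟩ := hsurj x
    exact (hg s).comp (Continuous.prodMk_right u)
  let curried : X → C(Y, Z) := fun x => ⟨fun y => g (x, y), hx x⟩
  have hcurried : Continuous curried := by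
    rw [htop, continuous_iSup_dom]
    intro s
    rw [continuous_coinduced_dom]
    exact ContinuousMap.continuous_of_continuous_uncurry _ (hg s)
  exact ContinuousMap.continuous_uncurry_of_continuous ⟨curried, hcurried⟩

section Topology

variable {n r : ℕ}

theorem continuous_incl (s : ℕ) : Continuous (incl s) :=
  continuous_iSup_rng (i := s) continuous_coinduced_rng

theorem continuous_stiefelIncl (r s : ℕ) : Continuous (stiefelIncl r s) :=
  continuous_iSup_rng (i := s) continuous_coinduced_rng

theorem continuous_cInf_dom {Z : Type*} [TopologicalSpace Z] {g : CInf → Z}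
    (hg : ∀ s, Continuous fun z => g (incl s z)) : Continuous g :=
  continuous_iSup_dom.2 fun s => continuous_coinduced_dom.2 (hg s)

theorem continuous_stiefel_dom {Z : Type*} [TopologicalSpace Z] {g : Stiefel r → Z}
    (hg : ∀ s, Continuous fun v => g (stiefelIncl r s v)) : Continuous g :=
  continuous_iSup_dom.2 fun s => continuous_coinduced_dom.2 (hg s)

theorem continuous_stiefel_prod_dom {Y Z : Type*} [TopologicalSpace Y] [LocallyCompactSpace Y]
    [TopologicalSpace Z] {g : Stiefel r × Y → Z}
    (hg : ∀ s, Continuous fun p : StiefelFin r s × Y => g (stiefelIncl r s p.1, p.2)) :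
    Continuous g :=
  continuous_uncurry_of_iSup_coinduced rfl exists_stiefelIncl hg

theorem continuous_stiefel_rng {s : ℕ} {Y : Type*} [TopologicalSpace Y] {g : Y → Stiefel r}
    {h : Y → Fin r → EuclideanSpace ℂ (Fin s)} (hh : Continuous h)
    (hgh : ∀ y i, incl s (h y i) = (g y).1 i) : Continuous g := by
  have horth : ∀ y, Orthonormal ℂ (h y) := fun y => by
    rw [orthonormal_iff_ite]
    intro i j
    rw [← herm_incl, hgh, hgh, (g y).2]
  have hg : g = fun y => stiefelIncl r s ⟨h y, horth y⟩ :=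
    funext fun y => Stiefel.ext (funext fun i => (hgh y i).symm)
  rw [hg]
  exact (continuous_stiefelIncl r s).comp (hh.subtype_mk horth)

theorem continuous_stiefelFin_apply {s : ℕ} (i : Fin r) :
    Continuous fun v : StiefelFin r s => v.1 i :=
  (continuous_apply i).comp continuous_subtype_val

theorem continuous_frame (i : Fin r) : Continuous fun v : Stiefel r => v.1 i :=
  continuous_stiefel_dom fun s =>
    (continuous_incl s).comp (continuous_stiefelFin_apply i)

theorem continuous_comb :
    Continuous fun p : Stiefel r × (Fin r → ℂ) => ∑ i, p.2 i • p.1.1 i := by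
  refine continuous_stiefel_prod_dom fun s => ?_
  have hcomb : Continuous fun p : StiefelFin r s × (Fin r → ℂ) => ∑ i, p.2 i • p.1.1 i :=
    continuous_finsetSum _ fun i _ => ((continuous_apply i).comp continuous_snd).smul
      ((continuous_stiefelFin_apply i).comp continuous_fst)
  refine ((continuous_incl s).comp hcomb).congr fun p => ?_
  simp only [Function.comp_apply, map_sum, map_smul]
  rfl

instance : LocallyCompactSpace (U r) :=
  have : LocallyCompactSpace (Matrix (Fin r) (Fin r) ℂ) :=
    inferInstanceAs (LocallyCompactSpace (Fin r → Fin r → ℂ))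
  isClosed_unitary.isClosedEmbedding_subtypeVal.locallyCompactSpace

theorem continuous_right_smul :
    Continuous fun p : Stiefel r × U r => MulOpposite.op p.2 • p.1 := by
  refine continuous_stiefel_prod_dom fun s => continuous_stiefel_rng
    (h := fun p : StiefelFin r s × U r => fun j => ∑ i, p.2.1 i j • p.1.1 i) ?_ fun p j => ?_
  · refine continuous_pi fun j => continuous_finsetSum _ fun i _ => ?_
    exact ((continuous_subtype_val.comp continuous_snd).matrix_elem i j).smul
      ((continuous_stiefelFin_apply i).comp continuous_fst)
  · simp only [map_sum, map_smul, Stiefel.right_smul_val]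
    rfl

instance : ContinuousSMul (U r)ᵐᵒᵖ (Stiefel r) where
  continuous_smul := by
    have hswap : Continuous fun q : (U r)ᵐᵒᵖ × Stiefel r => (q.2, q.1.unop) :=
      continuous_snd.prodMk (MulOpposite.continuous_unop.comp continuous_fst)
    exact (continuous_right_smul.comp hswap).congr fun q =>
      congrArg (· • q.2) (MulOpposite.op_unop q.1)

theorem isQuotientMap_span : Topology.IsQuotientMap (Stiefel.span : Stiefel r → Grass r) :=
  ⟨⟨rfl⟩, Stiefel.span_surjective r⟩

/-- The action of `γ` on the stage `ℂ^s` of `M`. -/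
noncomputable def diagFin (γ : Zn n) (s : ℕ) (z : EuclideanSpace ℂ (Fin s)) :
    EuclideanSpace ℂ (Fin s) :=
  WithLp.toLp 2 fun k => γ.val ^ (k.1 + 1) * z k

theorem incl_diagFin (γ : Zn n) (s : ℕ) (z : EuclideanSpace ℂ (Fin s)) :
    incl s (diagFin γ s z) = repM n γ (incl s z) := by
  ext k
  rw [repM_apply]
  obtain hk | hk := lt_or_ge k s
  · rw [incl_apply s _ ⟨k, hk⟩, incl_apply s _ ⟨k, hk⟩, diagFin]
  · rw [incl_apply_of_le _ _ k hk, incl_apply_of_le _ _ k hk, mul_zero]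

theorem continuous_diagFin (γ : Zn n) (s : ℕ) : Continuous (diagFin γ s) := by
  unfold diagFin
  fun_prop

theorem continuous_repM (γ : Zn n) : Continuous (repM n γ) :=
  continuous_cInf_dom fun s =>
    ((continuous_incl s).comp (continuous_diagFin γ s)).congr (incl_diagFin γ s)

variable [NeZero n]

theorem continuous_zn_smul (γ : Zn n) : Continuous fun v : Stiefel r => γ • v :=
  continuous_stiefel_dom fun s => continuous_stiefel_rng
    (h := fun v : StiefelFin r s => fun i => diagFin γ s (v.1 i))
    (continuous_pi fun i => (continuous_diagFin γ s).comp (continuous_stiefelFin_apply i))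
    fun v i => by
      rw [incl_diagFin, Stiefel.zn_smul_val]
      rfl

theorem continuous_grass_smul (γ : Zn n) : Continuous fun N : Grass r => γ • N :=
  isQuotientMap_span.continuous_iff.2 <|
    (isQuotientMap_span.continuous.comp (continuous_zn_smul γ)).congr (Stiefel.span_smul γ)

end Topology

section HermitianProduct

open scoped lp

/-- The inclusion of `ℂ^∞` in the Hilbert space `ℓ²`. -/
noncomputable def toEllTwo : CInf →ₗ[ℂ] ℓ²(ℕ, ℂ) where
  toFun z := ⟨fun k => z k, (memℓp_zero z.hasFiniteSupport).of_exponent_ge bot_le⟩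
  map_add' _ _ := rfl
  map_smul' _ _ := rfl

theorem herm_eq_inner_toEllTwo (z w : CInf) : herm z w = inner ℂ (toEllTwo z) (toEllTwo w) := by
  have hsupp : ∀ k ∉ z.support, inner ℂ (toEllTwo z k) (toEllTwo w k) = 0 := fun k hk => by
    change inner ℂ (z k) (w k) = 0
    rw [Finsupp.notMem_support_iff.1 hk, inner_zero_left]
  rw [lp.inner_eq_tsum, tsum_eq_sum hsupp, herm_eq_sum z w _ subset_rfl]
  exact Finset.sum_congr rfl fun k _ => mul_comm _ _

theorem continuous_toEllTwo : Continuous toEllTwo :=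
  continuous_cInf_dom fun s => (toEllTwo ∘ₗ incl s).continuous_of_finiteDimensional

theorem continuous_herm : Continuous fun p : CInf × CInf => herm p.1 p.2 := by
  simp only [herm_eq_inner_toEllTwo]
  exact (continuous_toEllTwo.comp continuous_fst).inner (continuous_toEllTwo.comp continuous_snd)

end HermitianProduct

section Frames

variable {r : ℕ}

/-- The matrix of Hermitian products of two frames. -/
noncomputable def crossGram (v w : Stiefel r) : Matrix (Fin r) (Fin r) ℂ :=
  Matrix.of fun i j => herm (v.1 i) (w.1 j)

theorem crossGram_self (v : Stiefel r) : crossGram v v = 1 :=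
  Matrix.ext fun i j => (v.2 i j).trans Matrix.one_apply.symm

theorem crossGram_right_smul (v w : Stiefel r) (a : U r) :
    crossGram v (MulOpposite.op a • w) = crossGram v w * a.1 := by
  ext i j
  rw [crossGram, Matrix.of_apply, Stiefel.right_smul_val, herm_sum_right, Matrix.mul_apply]
  exact Finset.sum_congr rfl fun k _ => mul_comm _ _

theorem continuous_crossGram (v : Stiefel r) : Continuous (crossGram v) :=
  continuous_pi fun _ => continuous_pi fun j =>
    continuous_herm.comp (continuous_const.prodMk (continuous_frame j))

theorem span_eq_span_iff (v w : Stiefel r) :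
    v.span = w.span ↔ ∃ a : U r, w = MulOpposite.op a • v :=
  ⟨Stiefel.exists_right_smul v w, fun ⟨a, ha⟩ => ha ▸ (Stiefel.span_right_smul v a).symm⟩

/-- The set of subspaces that project isomorphically onto the span of the frame `v`. -/
def grassChart (v : Stiefel r) : Set (Grass r) :=
  Stiefel.span '' {w | IsUnit (crossGram v w)}

theorem span_mem_grassChart {v w : Stiefel r} :
    w.span ∈ grassChart v ↔ IsUnit (crossGram v w) := by
  refine ⟨?_, fun hw => ⟨w, hw, rfl⟩⟩
  rintro ⟨u, hu, huw⟩
  obtain ⟨a, rfl⟩ := (span_eq_span_iff u w).1 huw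
  rw [crossGram_right_smul]
  exact hu.mul (Unitary.toUnits a).isUnit

theorem span_mem_grassChart_self (v : Stiefel r) : v.span ∈ grassChart v :=
  span_mem_grassChart.2 (crossGram_self v ▸ isUnit_one)

open scoped Matrix.Norms.L2Operator in
theorem isOpen_grassChart (v : Stiefel r) : IsOpen (grassChart v) := by
  have hpre : Stiefel.span ⁻¹' grassChart v = crossGram v ⁻¹' {a | IsUnit a} :=
    Set.ext fun _ => span_mem_grassChart
  rw [← isQuotientMap_span.isOpen_preimage, hpre]
  exact Units.isOpen.preimage (continuous_crossGram v)

open scoped Matrix.Norms.L2Operator MatrixOrder in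
/-- The unitary factor of the polar decomposition of the cross Gram matrix of `v` and `w`, as a
coordinate of `w`. -/
noncomputable def frameCoordinate (v w : Stiefel r) : U r :=
  polarUnitary (crossGram v w)

open scoped Matrix.Norms.L2Operator MatrixOrder in
theorem isFibreCoordinate_frameCoordinate (v : Stiefel r) :
    IsFibreCoordinate Stiefel.span (grassChart v) (frameCoordinate v) where
  isOpen := isOpen_grassChart v
  continuousOn := continuousOn_polarUnitary.comp (continuous_crossGram v).continuousOn
    fun _ => span_mem_grassChart.1
  map_op_smul w hw a := by
    rw [frameCoordinate, crossGram_right_smul]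
    exact polarUnitary_mul_unitary (span_mem_grassChart.1 hw) a

theorem isEquivariantPrincipalBundle_span (n r : ℕ) [NeZero n] :
    IsEquivariantPrincipalBundle (Zn n) (U r) (Stiefel.span : Stiefel r → Grass r) where
  continuous_proj := isQuotientMap_span.continuous
  continuous_smul_base := continuous_grass_smul
  continuous_smul := continuous_zn_smul
  continuous_right_smul := continuous_right_smul
  proj_smul := Stiefel.span_smul
  proj_right_smul := Stiefel.span_right_smul
  smul_right_smul := Stiefel.smul_right_smul
  locally_trivial N := by
    obtain ⟨v, rfl⟩ := Stiefel.span_surjective r N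
    have hR := isFibreCoordinate_frameCoordinate v
    obtain ⟨e, hbase, he⟩ := hR.exists_trivialization isQuotientMap_span span_eq_span_iff
    refine ⟨e, hbase ▸ span_mem_grassChart_self v, fun w hw a => ?_⟩
    rw [he, he]
    exact hR.map_op_smul w (hbase ▸ hw) a

theorem exists_local_frame (N : Grass r) :
    ∃ (O : Set (Grass r)) (σ : Grass r → Stiefel r),
      IsOpen O ∧ N ∈ O ∧ ContinuousOn σ O ∧ ∀ N', (σ N').span = N' := by
  obtain ⟨v, rfl⟩ := Stiefel.span_surjective r N
  have hR := isFibreCoordinate_frameCoordinate v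
  exact ⟨grassChart v, coordinateSection (Stiefel.span_surjective r) (frameCoordinate v),
    hR.isOpen, span_mem_grassChart_self v,
    hR.continuousOn_coordinateSection isQuotientMap_span span_eq_span_iff,
    proj_coordinateSection _ _ span_eq_span_iff⟩

/-- The coordinates `⟨v_i, z⟩` of the orthogonal projection of `z` to the span of `v`. -/
noncomputable def Stiefel.coords (v : Stiefel r) : CInf →ₗ[ℂ] Fin r → ℂ :=
  LinearMap.pi fun i => hermL (v.1 i)

theorem Stiefel.coords_comb (v : Stiefel r) (y : Fin r → ℂ) :
    v.coords (∑ i, y i • v.1 i) = y :=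
  funext (v.herm_comb y)

theorem Stiefel.comb_coords (v : Stiefel r) {z : CInf} (hz : z ∈ v.span.1) :
    ∑ i, v.coords z i • v.1 i = z := by
  obtain ⟨y, rfl⟩ := (Submodule.mem_span_range_iff_exists_fun ℂ).1 hz
  rw [v.coords_comb]

/-- A frame identifies `ℂ^r` with its span, by `y ↦ ∑ i, y_i v_i`. -/
noncomputable def Stiefel.spanEquiv (v : Stiefel r) : (Fin r → ℂ) ≃ₗ[ℂ] v.span.1 where
  toLinearMap := (Fintype.linearCombination ℂ v.1).codRestrict v.span.1 fun y =>
    (Submodule.mem_span_range_iff_exists_fun ℂ).2 ⟨y, rfl⟩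
  invFun z := v.coords z
  left_inv := v.coords_comb
  right_inv z := Subtype.ext (v.comb_coords z.2)

theorem continuous_coords :
    Continuous fun p : Stiefel r × CInf => p.1.coords p.2 :=
  continuous_pi fun i =>
    continuous_herm.comp (((continuous_frame i).comp continuous_fst).prodMk continuous_snd)

end Frames

section TautologicalBundle

variable {r : ℕ}

theorem isInducing_tautToProd : Topology.IsInducing (tautToProd r) := ⟨rfl⟩

theorem continuous_taut_proj :
    Continuous (TotalSpace.proj : TotalSpace (Fin r → ℂ) (TautFibre r) → Grass r) :=
  continuous_fst.comp isInducing_tautToProd.continuous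

theorem continuous_taut_vector :
    Continuous fun x : TotalSpace (Fin r → ℂ) (TautFibre r) => (x.2 : CInf) :=
  continuous_snd.comp isInducing_tautToProd.continuous

/-- The point `(⟨v_1, …, v_r⟩, ∑ i, y_i v_i)` of `E_M`. -/
noncomputable def tautMk (v : Stiefel r) (y : Fin r → ℂ) :
    TotalSpace (Fin r → ℂ) (TautFibre r) :=
  ⟨v.span, v.spanEquiv y⟩

theorem tautToProd_tautMk (v : Stiefel r) (y : Fin r → ℂ) :
    tautToProd r (tautMk v y) = (v.span, ∑ i, y i • v.1 i) :=
  rfl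

theorem tautMk_coords {v : Stiefel r} {x : TotalSpace (Fin r → ℂ) (TautFibre r)}
    (hv : v.span = x.1) : tautMk v (v.coords x.2) = x :=
  tautToProd_injective r (Prod.ext hv (v.comb_coords (by rw [hv]; exact x.2.2)))

theorem tautMk_right_smul (v : Stiefel r) (a : U r) (y : Fin r → ℂ) :
    tautMk (MulOpposite.op a • v) y = tautMk v (a.1.mulVec y) := by
  refine tautToProd_injective r (Prod.ext (Stiefel.span_right_smul v a) ?_)
  calc ∑ j, y j • (MulOpposite.op a • v).1 j
      = ∑ j, ∑ i, (a.1 i j * y j) • v.1 i := by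
        simp only [Stiefel.right_smul_val, Finset.smul_sum, smul_smul, mul_comm]
    _ = ∑ i, a.1.mulVec y i • v.1 i := by
        rw [Finset.sum_comm]
        simp only [← Finset.sum_smul, Matrix.mulVec, dotProduct]

theorem smul_tautMk {n : ℕ} [NeZero n] (γ : Zn n) (v : Stiefel r) (y : Fin r → ℂ) :
    γ • tautMk v y = tautMk (γ • v) y := by
  refine tautToProd_injective r (Prod.ext (Stiefel.span_smul γ v).symm ?_)
  change repM n γ (∑ i, y i • v.1 i) = ∑ i, y i • (γ • v).1 i
  simp only [map_sum, map_smul, Stiefel.zn_smul_val]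

theorem continuous_tautMk :
    Continuous fun p : Stiefel r × (Fin r → ℂ) => tautMk p.1 p.2 :=
  isInducing_tautToProd.continuous_iff.2 <|
    (isQuotientMap_span.continuous.comp continuous_fst).prodMk continuous_comb

theorem continuousOn_taut_coords {O : Set (Grass r)} {σ : Grass r → Stiefel r}
    (hσ : ContinuousOn σ O) :
    ContinuousOn (fun x : TotalSpace (Fin r → ℂ) (TautFibre r) => (σ x.1).coords x.2)
      (TotalSpace.proj ⁻¹' O) := by
  have hpair : ContinuousOn (fun x : TotalSpace (Fin r → ℂ) (TautFibre r) =>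
      (σ x.1, (x.2 : CInf))) (TotalSpace.proj ⁻¹' O) :=
    (hσ.comp continuous_taut_proj.continuousOn fun _ => id).prodMk
      continuous_taut_vector.continuousOn
  exact (continuous_coords.comp_continuousOn hpair :)

theorem exists_taut_trivialization {O : Set (Grass r)} (hO : IsOpen O) {σ : Grass r → Stiefel r}
    (hσ : ContinuousOn σ O) (hspan : ∀ N, (σ N).span = N) :
    ∃ e : Trivialization (Fin r → ℂ)
        (TotalSpace.proj : TotalSpace (Fin r → ℂ) (TautFibre r) → Grass r),
      e.baseSet = O ∧ e.IsLinear ℂ := by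
  have hψ : ContinuousOn (fun q : Grass r × (Fin r → ℂ) => tautMk (σ q.1) q.2)
      (O ×ˢ Set.univ) := by
    have hpair : ContinuousOn (fun q : Grass r × (Fin r → ℂ) => (σ q.1, q.2)) (O ×ˢ Set.univ) :=
      (hσ.comp continuousOn_fst fun _ hq => hq.1).prodMk continuousOn_snd
    exact (continuous_tautMk.comp_continuousOn hpair :)
  obtain ⟨e, hbase, he⟩ := exists_trivialization_of_continuousOn continuous_taut_proj hO
    (continuousOn_taut_coords hσ) hψ (fun N _ _ => hspan N)
    (fun N _ y => by
      change (σ (σ N).span).coords (∑ i, y i • (σ N).1 i) = y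
      rw [hspan, Stiefel.coords_comb])
    (fun x _ => tautMk_coords (hspan x.1))
  refine ⟨e, hbase, ⟨fun N _ => ?_⟩⟩
  simp only [he]
  exact ((σ N).coords ∘ₗ N.1.subtype).isLinear

theorem isEquivariantVectorBundle_taut (n r : ℕ) [NeZero n] :
    IsEquivariantVectorBundle (Zn n) (Fin r → ℂ) (TautFibre r) where
  continuous_proj := continuous_taut_proj
  locally_trivial N := by
    obtain ⟨O, σ, hO, hN, hσ, hspan⟩ := exists_local_frame N
    obtain ⟨e, hbase, he⟩ := exists_taut_trivialization hO hσ hspan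
    exact ⟨e, hbase ▸ hN, he⟩
  continuous_smul_base := continuous_grass_smul
  continuous_smul γ := isInducing_tautToProd.continuous_iff.2 <|
    ((continuous_grass_smul γ).comp continuous_taut_proj).prodMk
      ((continuous_repM γ).comp continuous_taut_vector)
  smul_linear γ N := ⟨(repM n γ).restrict fun _ hz => Submodule.mem_map_of_mem hz, fun _ => rfl⟩

end TautologicalBundle

section AssociatedBundle

variable {r : ℕ}

theorem Assoc.exists_mk_of_proj_eq (q : Assoc r) (v : Stiefel r) (hq : q.proj = v.span) :
    ∃ y, Assoc.mk v y = q := by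
  obtain ⟨y, hy⟩ := (frameEquiv v v.span rfl).surjective ⟨q, hq⟩
  exact ⟨y, congrArg AssocFibre.point hy⟩

theorem Assoc.exists_mk (q : Assoc r) : ∃ v y, Assoc.mk v y = q :=
  let ⟨v, hv⟩ := Stiefel.span_surjective r q.proj
  ⟨v, q.exists_mk_of_proj_eq v hv.symm⟩

theorem Assoc.continuous_mk :
    Continuous fun p : Stiefel r × (Fin r → ℂ) => Assoc.mk p.1 p.2 :=
  continuous_quotient_mk'

/-- The map `[v, y] ↦ (⟨v_1, …, v_r⟩, ∑ i, y_i v_i)` of total spaces. -/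
noncomputable def assocToTaut : Assoc r → TotalSpace (Fin r → ℂ) (TautFibre r) :=
  Quotient.lift (fun p => tautMk p.1 p.2) fun p q ⟨a, hv, hy⟩ => by
    rw [hv, hy, tautMk_right_smul]

theorem assocToTaut_mk (v : Stiefel r) (y : Fin r → ℂ) :
    assocToTaut (Assoc.mk v y) = tautMk v y :=
  rfl

theorem continuous_assocToTaut : Continuous (assocToTaut (r := r)) :=
  continuous_tautMk.quotient_lift _

theorem assocToTaut_smul {n : ℕ} [NeZero n] (γ : Zn n) (q : Assoc r) :
    assocToTaut (γ • q) = γ • assocToTaut q := by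
  obtain ⟨v, y, rfl⟩ := q.exists_mk
  rw [Assoc.smul_mk, assocToTaut_mk, assocToTaut_mk, smul_tautMk]

theorem proj_assocToTaut (q : Assoc r) : (assocToTaut q).proj = q.proj := by
  obtain ⟨v, y, rfl⟩ := q.exists_mk
  rfl

theorem mk_coords_assocToTaut {v : Stiefel r} {q : Assoc r} (hv : v.span = q.proj) :
    Assoc.mk v (v.coords (assocToTaut q).2) = q := by
  obtain ⟨y, rfl⟩ := q.exists_mk_of_proj_eq v hv.symm
  exact congrArg (Assoc.mk v) (v.coords_comb y)

/-- The bijection `assocToTaut`. Its inverse is computed in an arbitrary orthonormal frame of the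
subspace, see `assocEquivTaut_symm_eq`. -/
noncomputable def assocEquivTaut : Assoc r ≃ TotalSpace (Fin r → ℂ) (TautFibre r) where
  toFun := assocToTaut
  invFun x :=
    let v := Function.surjInv (Stiefel.span_surjective r) x.1
    Assoc.mk v (v.coords x.2)
  left_inv q := mk_coords_assocToTaut ((Function.surjInv_eq _ _).trans (proj_assocToTaut q))
  right_inv _ := tautMk_coords (Function.surjInv_eq _ _)

theorem assocEquivTaut_symm_eq {v : Stiefel r} {x : TotalSpace (Fin r → ℂ) (TautFibre r)}
    (hv : v.span = x.1) : assocEquivTaut.symm x = Assoc.mk v (v.coords x.2) :=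
  assocEquivTaut.symm_apply_eq.2 (tautMk_coords hv).symm

theorem continuous_assocEquivTaut_symm : Continuous (assocEquivTaut (r := r)).symm := by
  refine continuous_iff_continuousAt.2 fun x => ?_
  obtain ⟨O, σ, hO, hx, hσ, hspan⟩ := exists_local_frame x.1
  have hlocal : ContinuousOn (fun x : TotalSpace (Fin r → ℂ) (TautFibre r) =>
      Assoc.mk (σ x.1) ((σ x.1).coords x.2)) (TotalSpace.proj ⁻¹' O) :=
    Assoc.continuous_mk.comp_continuousOn <|
      (hσ.comp continuous_taut_proj.continuousOn fun _ => id).prodMk (continuousOn_taut_coords hσ)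
  exact (hlocal.congr fun x _ => assocEquivTaut_symm_eq (hspan x.1)).continuousAt
    ((hO.preimage continuous_taut_proj).mem_nhds hx)

theorem isHomeomorph_assocToTaut : IsHomeomorph (assocToTaut (r := r)) :=
  (Homeomorph.mk assocEquivTaut continuous_assocToTaut
    continuous_assocEquivTaut_symm).isHomeomorph

theorem isHomeomorph_assocTotalEquiv (r : ℕ) : IsHomeomorph (assocTotalEquiv r) :=
  ((assocTotalEquiv r).toHomeomorphOfIsInducing ⟨rfl⟩).isHomeomorph

/-- The identification `y ↦ [v, y]` of `ℂ^r` with the fibre over the span of `v` is linear. -/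
noncomputable def AssocFibre.ofFrameEquiv (v : Stiefel r) :
    (Fin r → ℂ) ≃ₗ[ℂ] AssocFibre r v.span where
  toEquiv := frameEquiv v v.span rfl
  map_add' y z := (AssocFibre.ofFrame_add v y z).symm
  map_smul' c y := (AssocFibre.ofFrame_smul v c y).symm

theorem assocToTaut_fibre_linear (N : Grass r) :
    ∃ L : AssocFibre r N ≃ₗ[ℂ] TautFibre r N, ∀ x : AssocFibre r N,
      assocToTaut x.1 = ⟨N, L x⟩ := by
  obtain ⟨v, rfl⟩ := Stiefel.span_surjective r N
  refine ⟨(AssocFibre.ofFrameEquiv v).symm ≪≫ₗ v.spanEquiv, fun x => ?_⟩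
  obtain ⟨y, rfl⟩ := (AssocFibre.ofFrameEquiv v).surjective x
  rw [LinearEquiv.trans_apply, LinearEquiv.symm_apply_apply]
  rfl

theorem isEquivariantVectorBundleIso_assocToTaut (n r : ℕ) [NeZero n] :
    IsEquivariantVectorBundleIso (Zn n)
      (fun x : TotalSpace (Fin r → ℂ) (AssocFibre r) => assocToTaut (assocTotalEquiv r x)) where
  isHomeomorph := isHomeomorph_assocToTaut.comp (isHomeomorph_assocTotalEquiv r)
  fibre_linear := assocToTaut_fibre_linear
  equivariant γ x := by
    rw [← assocToTaut_smul]
    exact congrArg assocToTaut ((assocTotalEquiv r).apply_symm_apply _)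

end AssociatedBundle

end SegalBundle

theorem theorem4p1 (n r : ℕ) [NeZero n] :
    IsEquivariantPrincipalBundle (Zn n) (U r) (Stiefel.span : Stiefel r → Grass r) ∧
    IsEquivariantVectorBundle (Zn n) (Fin r → ℂ) (AssocFibre r) ∧
    IsEquivariantVectorBundle (Zn n) (Fin r → ℂ) (TautFibre r) ∧
    ∃ f : TotalSpace (Fin r → ℂ) (AssocFibre r) → TotalSpace (Fin r → ℂ) (TautFibre r),
      IsEquivariantVectorBundleIso (Zn n) f ∧
      ∀ (v : Stiefel r) (y : Fin r → ℂ),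
        tautToProd r (f ((assocTotalEquiv r).symm (Assoc.mk v y))) =
          (v.span, ∑ i, y i • v.1 i) := by
  have hiso := isEquivariantVectorBundleIso_assocToTaut n r
  have htaut := isEquivariantVectorBundle_taut n r
  exact ⟨isEquivariantPrincipalBundle_span n r, htaut.of_iso hiso, htaut, _, hiso,
    tautToProd_tautMk⟩
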